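/- A ball-recycling game has $m$ balls, $n$ bins and a probability distribution $\mathbf p=(p_1,\dots,p_n)$ on the bins. A configuration is a vector $X=(X_1,\dots,X_n)$ of nonnegative integers with $\sum_i X_i=m$. In every round a non-empty bin $\ell$ is selected and recycled: its $X_\ell$ balls are removed and re-thrown independently according to $\mathbf p$; $X_\ell$ is the number of balls recycled in that round. A recycling strategy $A$ has a set of internal states (arbitrary, so that it may record time and the whole history); from the current configuration and internal state it selects, possibly at random, a non-empty bin and its next internal state. It is stateless if it has a single internal state. For an initial law of the configuration and internal state, let $r_t$ be the expected number of balls recycled in round $t$ ($t=0,1,2,\dots$); the recycling rate is $\mathcal R^A=\lim_{T\to\infty}\frac1T\sum_{t=0}^{T}r_t$ when the limit exists. A stationary distribution is a law of (configuration, internal state) that is invariant under one round, and the recycling rate in it is the expected number of balls recycled in a round started from that law. Let $\|\mathbf p\|_{1/2}=\bigl(\sum_i\sqrt{p_i}\bigr)^2$. (a) For every recycling strategy $A$ and every initial law, $$\limsup_{T\to\infty}\frac1T\sum_{t=0}^{T}r_t\le\frac{2m+n-1}{\|\mathbf p\|_{1/2}};$$ in particular $\mathcal R^A\le\frac{2m+n-1}{\|\mathbf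 p\|_{1/2}}$ whenever the recycling rate exists. The same bound holds for the recycling rate in any stationary distribution. (b) Suppose that $p_j>0$ for all $j$ and that $A$ is stateless. For a stationary distribution $\chi$, let $\mathcal R^A$ be the recycling rate in $\chi$ and $f_j$ the probability that $A$ selects bin $j$ in a round started from $\chi$. Then $f_j>0$ for all $j$ and $$\mathcal R^A\le\frac{2m+n-1}{\sum_{j}p_j/f_j}.$$ The same holds if, for some initial law, $\mathcal R^A$ is the recycling rate and $f_j=\lim_{T\to\infty}\frac1T\sum_{t=0}^{T}\Pr[A\text{ selects bin }j\text{ in round }t]$, provided that these limits exist. -/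

import Mathlib

open Filter Topology
open scoped ENNReal

universe u

namespace BallRecycling

/-- Configurations of `m` balls in `n` bins: `X.1 i` is the number of balls in bin `i`. -/
abbrev Config (n m : ℕ) : Type := {X : Fin n → ℕ // ∑ i, X i = m}

/-- The half quasi-norm `(∑ √(p i))²`. -/
noncomputable def halfNorm {n : ℕ} (p : PMF (Fin n)) : ℝ :=
  (∑ i, Real.sqrt (p i).toReal) ^ 2

/-- The law of the landing positions of `k` balls thrown i.i.d. according to `p`
(the `k`-fold product distribution). -/
noncomputable def throwLaw {n : ℕ} (p : PMF (Fin n)) (k : ℕ) : PMF (Fin k → Fin n) :=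
  PMF.ofFintype (fun ω => ∏ i, p (ω i)) (by
    have h := Fintype.sum_pow (fun j : Fin n => p j) k
    rw [← h, ← tsum_fintype (L := .unconditional _), p.tsum_coe, one_pow])

/-- The configuration obtained from `X` by emptying bin `l` and putting its `X.1 l` balls into
the bins listed by `ω`. -/
def refill {n m : ℕ} (X : Config n m) (l : Fin n) (ω : Fin (X.1 l) → Fin n) : Config n m :=
  ⟨fun j => (if j = l then 0 else X.1 j) + (Finset.univ.filter fun i => ω i = j).card, by
    have h1 : ∑ j, (Finset.univ.filter fun i => ω i = j).card = X.1 l := by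
      rw [← Finset.card_eq_sum_card_fiberwise (f := ω) (fun _ _ => Finset.mem_univ _)]
      simp
    have h2 : (∑ j, if j = l then 0 else X.1 j) + X.1 l = ∑ j, X.1 j := by
      rw [← Finset.sum_erase_add Finset.univ (fun j => if j = l then 0 else X.1 j) (Finset.mem_univ l),
        ← Finset.sum_erase_add Finset.univ X.1 (Finset.mem_univ l)]
      simp only [if_true, add_zero]
      congr 1
      exact Finset.sum_congr rfl fun j hj => if_neg (Finset.ne_of_mem_erase hj)
    rw [Finset.sum_add_distrib, h1, h2, X.2]⟩

/-- The law of the next configuration when bin `l` of `X` is recycled. -/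
noncomputable def recycle {n m : ℕ} (p : PMF (Fin n)) (X : Config n m) (l : Fin n) :
    PMF (Config n m) :=
  (throwLaw p (X.1 l)).map (refill X l)

/-- A (randomized) recycling strategy with internal states in `S`: from the current configuration
and internal state it selects, possibly at random, a bin to recycle together with its next
internal state, and the selected bin is never empty.  As `S` is arbitrary (it may hold the number
of elapsed rounds, or the whole history of play), these are all policies of the game.
The strategy is stateless when `S` is `Unit`. -/
structure Strategy (n m : ℕ) (S : Type u) where
  select : Config n m → S → PMF (Fin n × S)
  bin_nonempty : ∀ X s d, d ∈ (select X s).support → 0 < X.1 d.1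

/-- One round: the law of the next (configuration, internal state). -/
noncomputable def step {n m : ℕ} {S : Type u} (p : PMF (Fin n)) (A : Strategy n m S)
    (z : Config n m × S) : PMF (Config n m × S) :=
  (A.select z.1 z.2).bind fun d => (recycle p z.1 d.1).map fun Y => (Y, d.2)

/-- The law of (configuration, internal state) after `t` rounds, started from the law `ν`. -/
noncomputable def law {n m : ℕ} {S : Type u} (p : PMF (Fin n)) (A : Strategy n m S)
    (ν : PMF (Config n m × S)) : ℕ → PMF (Config n m × S)
  | 0 => ν
  | t + 1 => (law p A ν t).bind (step p A)

/-- `χ` is a stationary distribution of the Markov process given by the game and `A`. -/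
def IsStationary {n m : ℕ} {S : Type u} (p : PMF (Fin n)) (A : Strategy n m S)
    (χ : PMF (Config n m × S)) : Prop :=
  χ.bind (step p A) = χ

/-- The joint law of the current configuration and the bin that `A` selects, when
(configuration, internal state) has law `μ`. -/
noncomputable def choiceLaw {n m : ℕ} {S : Type u} (A : Strategy n m S)
    (μ : PMF (Config n m × S)) : PMF (Config n m × Fin n) :=
  μ.bind fun z => (A.select z.1 z.2).map fun d => (z.1, d.1)

/-- The expected number of balls recycled in the next round when (configuration, internal state)
has law `μ`; the sum is at most `m`, hence finite. -/
noncomputable def meanRecycled {n m : ℕ} {S : Type u} (A : Strategy n m S)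
    (μ : PMF (Config n m × S)) : ℝ :=
  (∑' c : Config n m × Fin n, choiceLaw A μ c * (c.1.1 c.2 : ℝ≥0∞)).toReal

/-- The probability that bin `j` is selected when (configuration, internal state) has law `μ`. -/
noncomputable def pickProb {n m : ℕ} {S : Type u} (A : Strategy n m S)
    (μ : PMF (Config n m × S)) (j : Fin n) : ℝ :=
  ((choiceLaw A μ).map Prod.snd j).toReal

/-- The expected average `(1/T) ∑_{t=0}^{T}` of the numbers of balls recycled. -/
noncomputable def avgRecycled {n m : ℕ} {S : Type u} (p : PMF (Fin n)) (A : Strategy n m S)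
    (ν : PMF (Config n m × S)) (T : ℕ) : ℝ :=
  (1 / (T : ℝ)) * ∑ t ∈ Finset.range (T + 1), meanRecycled A (law p A ν t)

/-- The expected average number of rounds in which bin `j` is selected. -/
noncomputable def avgPick {n m : ℕ} {S : Type u} (p : PMF (Fin n)) (A : Strategy n m S)
    (ν : PMF (Config n m × S)) (j : Fin n) (T : ℕ) : ℝ :=
  (1 / (T : ℝ)) * ∑ t ∈ Finset.range (T + 1), pickProb A (law p A ν t) j

/-- From the initial law `ν`, the recycling rate of `A` (the limit of the expected averages)
exists and equals `R`. -/
def HasRecyclingRate {n m : ℕ} {S : Type u} (p : PMF (Fin n)) (A : Strategy n m S)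
    (ν : PMF (Config n m × S)) (R : ℝ) : Prop :=
  Tendsto (avgRecycled p A ν) atTop (𝓝 R)

/-- From the initial law `ν`, the long-run frequency with which `A` picks bin `j` exists and
equals `f`. -/
def HasPickFrequency {n m : ℕ} {S : Type u} (p : PMF (Fin n)) (A : Strategy n m S)
    (ν : PMF (Config n m × S)) (j : Fin n) (f : ℝ) : Prop :=
  Tendsto (avgPick p A ν j) atTop (𝓝 f)

end BallRecycling

namespace BallRecycling

/-! The proof is a drift argument. If `V` is a function of the configuration and every legal move
`l` from `X` satisfies `a * X_l + β l ≤ V X - E V(next)`, then averaging over the play telescopes.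
Since `V` is bounded, any long-run rate `R` and frequencies `f` satisfy `a * R + ∑ β j * f j ≤ 0`;
under a stationary law the two `V` terms cancel exactly.

The potential is `∑ (X_i² / p_i - 2 θ_i X_i)`. Recycling `k = X_l` balls creates cross terms summing
to `2mk` and binomial variances summing to `(n - 1)k`, which is the source of `2m + n - 1`. Emptying
bin `l` contributes `-k² / p_l + 2 θ_l k ≤ θ_l² p_l`. Hence (`drift_potential`) `(2 ∑ θ_i p_i - (2m
+ n - 1)) k - θ_l² p_l` bounds the drift from below.

For (a), `θ_i` proportional to `1 / √p_i` makes the penalty `θ_l² p_l` the same for all bins with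
`p_l > 0`, so frequencies play no role (`exists_drift_halfNorm`). For (b), `θ_j = R / f_j` maximizes
`2R ∑ θ_j p_j - ∑ θ_j² p_j f_j` (`frequency_bound`). -/

noncomputable instance instFintypeConfig (n m : ℕ) : Fintype (Config n m) :=
  have : Finite (Config n m) :=
    Finite.of_injective (β := Fin n → Fin (m + 1))
      (fun X i => ⟨X.1 i, Nat.lt_succ_of_le
        ((Finset.single_le_sum (fun _ _ => Nat.zero_le _) (Finset.mem_univ i)).trans X.2.le)⟩)
      (fun _ _ h => Subtype.ext (funext fun i => congrArg Fin.val (congrFun h i)))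
  Fintype.ofFinite _

/-- The mean of a real function under a law on a finite type. -/
noncomputable def mean {α : Type*} [Fintype α] (μ : PMF α) (g : α → ℝ) : ℝ :=
  ∑ a, (μ a).toReal * g a

/-! ### Expectations under laws on finite types. -/

section Mean

variable {α β : Type*} [Fintype α] [Fintype β]

lemma mean_bind (μ : PMF α) (κ : α → PMF β) (g : β → ℝ) :
    mean (μ.bind κ) g = mean μ fun a => mean (κ a) g := by
  simp only [mean, PMF.bind_apply, tsum_fintype, Finset.mul_sum]
  rw [Finset.sum_comm]
  refine Finset.sum_congr rfl fun b _ => ?_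
  rw [ENNReal.toReal_sum fun a _ => ENNReal.mul_ne_top (μ.apply_ne_top a) ((κ a).apply_ne_top b),
    Finset.sum_mul]
  exact Finset.sum_congr rfl fun a _ => by rw [ENNReal.toReal_mul, mul_assoc]

lemma mean_pure (a : α) (g : α → ℝ) : mean (PMF.pure a) g = g a := by
  classical
  simp [mean, PMF.pure_apply, apply_ite ENNReal.toReal]

lemma mean_map (μ : PMF α) (f : α → β) (g : β → ℝ) :
    mean (μ.map f) g = mean μ fun a => g (f a) := by
  rw [← PMF.bind_pure_comp, mean_bind]
  simp only [Function.comp, mean_pure]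

lemma sum_toReal_eq_one (μ : PMF α) : ∑ a, (μ a).toReal = 1 := by
  rw [← ENNReal.toReal_sum fun a _ => μ.apply_ne_top a, ← tsum_fintype (L := .unconditional _),
    μ.tsum_coe, ENNReal.toReal_one]

lemma mean_const (μ : PMF α) (c : ℝ) : mean μ (fun _ => c) = c := by
  rw [mean, ← Finset.sum_mul, sum_toReal_eq_one, one_mul]

lemma mean_add (μ : PMF α) (g h : α → ℝ) :
    mean μ (fun a => g a + h a) = mean μ g + mean μ h := by
  simp [mean, mul_add, Finset.sum_add_distrib]

lemma mean_sub (μ : PMF α) (g h : α → ℝ) :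
    mean μ (fun a => g a - h a) = mean μ g - mean μ h := by
  simp [mean, mul_sub, Finset.sum_sub_distrib]

lemma mean_const_mul (μ : PMF α) (c : ℝ) (g : α → ℝ) :
    mean μ (fun a => c * g a) = c * mean μ g := by
  simp only [mean, Finset.mul_sum]
  exact Finset.sum_congr rfl fun a _ => by ring

lemma mean_finset_sum {ι : Type*} (μ : PMF α) (s : Finset ι) (g : ι → α → ℝ) :
    mean μ (fun a => ∑ i ∈ s, g i a) = ∑ i ∈ s, mean μ (g i) := by
  simp only [mean, Finset.mul_sum]
  exact Finset.sum_comm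

lemma mean_mono (μ : PMF α) {g h : α → ℝ} (H : ∀ a ∈ μ.support, g a ≤ h a) :
    mean μ g ≤ mean μ h := by
  refine Finset.sum_le_sum fun a _ => ?_
  by_cases ha : μ a = 0
  · simp [ha]
  · exact mul_le_mul_of_nonneg_left (H a ((μ.mem_support_iff a).2 ha)) ENNReal.toReal_nonneg

end Mean

/-! ### First and second moments of the binomial landing counts. -/

section Throw

variable {n : ℕ} (p : PMF (Fin n)) (k : ℕ) (j : Fin n)

/-- All throws indexed by `s` land in bin `j` with probability `p j ^ s.card`. -/
lemma mean_throwLaw_all (s : Finset (Fin k)) :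
    mean (throwLaw p k) (fun ω => if ∀ i ∈ s, ω i = j then 1 else 0) = (p j).toReal ^ s.card := by
  -- The indicator is a product over the throws, so the expectation factorizes by independence.
  have h1 : ∀ ω : Fin k → Fin n,
      (throwLaw p k ω).toReal * (if ∀ i ∈ s, ω i = j then (1 : ℝ) else 0)
        = ∏ i, (p (ω i)).toReal * (if i ∈ s → ω i = j then 1 else 0) := by
    intro ω
    rw [Finset.prod_mul_distrib, throwLaw, PMF.ofFintype_apply, ENNReal.toReal_prod]
    congr 1
    rw [Finset.prod_ite_zero]
    simp
  rw [mean, Finset.sum_congr rfl fun ω _ => h1 ω,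
    ← Fintype.prod_sum (fun i x => (p x).toReal * (if i ∈ s → x = j then (1 : ℝ) else 0))]
  have h2 : ∀ i, ∑ x, (p x).toReal * (if i ∈ s → x = j then (1 : ℝ) else 0)
      = if i ∈ s then (p j).toReal else 1 := by
    intro i
    by_cases hi : i ∈ s
    · simp [hi]
    · simp [hi, sum_toReal_eq_one]
  rw [Finset.prod_congr rfl fun i _ => h2 i]
  simp

/-- The number of throws that land in bin `j`, as a sum of indicators. -/
lemma card_landing (ω : Fin k → Fin n) :
    ((Finset.univ.filter fun i => ω i = j).card : ℝ) = ∑ i, if ω i = j then 1 else 0 := by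
  simp

lemma mean_throwLaw_card :
    mean (throwLaw p k) (fun ω => ((Finset.univ.filter fun i => ω i = j).card : ℝ))
      = k * (p j).toReal := by
  simp only [card_landing]
  rw [mean_finset_sum]
  have h : ∀ i, mean (throwLaw p k) (fun ω => if ω i = j then 1 else 0) = (p j).toReal := by
    intro i
    simpa using mean_throwLaw_all p k j {i}
  simp [h]

lemma mean_throwLaw_card_sq :
    mean (throwLaw p k) (fun ω => ((Finset.univ.filter fun i => ω i = j).card : ℝ) ^ 2)
      = k * (p j).toReal * (1 - (p j).toReal) + (k * (p j).toReal) ^ 2 := by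
  simp only [card_landing, sq, Finset.sum_mul_sum]
  rw [mean_finset_sum]
  have h : ∀ i i', mean (throwLaw p k)
      (fun ω => (if ω i = j then 1 else 0) * (if ω i' = j then 1 else 0))
      = (p j).toReal ^ 2 + if i = i' then (p j).toReal - (p j).toReal ^ 2 else 0 := by
    intro i i'
    have e := mean_throwLaw_all p k j {i, i'}
    simp only [Finset.mem_insert, Finset.mem_singleton, forall_eq_or_imp, forall_eq] at e
    simp only [ite_zero_mul_ite_zero, mul_one]
    rw [e]
    by_cases hi : i = i'
    · simp [hi]
    · simp [hi, Finset.card_pair hi]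
  simp only [mean_finset_sum, h, Finset.sum_add_distrib]
  simp
  ring

end Throw

/-! ### Drift of the quadratic potential under one recycling move. -/

section Recycle

variable {n m : ℕ} (p : PMF (Fin n)) (X : Config n m) (l j : Fin n)

lemma mean_recycle (V : Config n m → ℝ) :
    mean (recycle p X l) V = mean (throwLaw p (X.1 l)) fun ω => V (refill X l ω) :=
  mean_map _ _ _

lemma mean_recycle_apply :
    mean (recycle p X l) (fun Y => (Y.1 j : ℝ))
      = X.1 j + X.1 l * (p j).toReal - if j = l then (X.1 l : ℝ) else 0 := by
  simp only [mean_recycle, refill, Nat.cast_add]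
  rw [mean_add, mean_const, mean_throwLaw_card]
  split_ifs with h
  · subst h; push_cast; ring
  · ring

lemma mean_recycle_apply_sq :
    mean (recycle p X l) (fun Y => (Y.1 j : ℝ) ^ 2)
      = X.1 j ^ 2 + 2 * (X.1 l * (p j).toReal) * X.1 j
        + X.1 l * (p j).toReal * (1 - (p j).toReal) + (X.1 l * (p j).toReal) ^ 2
        - if j = l then (X.1 l : ℝ) ^ 2 + 2 * (p j).toReal * X.1 l ^ 2 else 0 := by
  simp only [mean_recycle, refill, Nat.cast_add, add_sq]
  rw [mean_add, mean_add, mean_const, mean_const_mul, mean_throwLaw_card, mean_throwLaw_card_sq]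
  split_ifs with h
  · subst h; push_cast; ring
  · ring

/-- A quadratic potential, with one free linear coefficient for each bin. -/
noncomputable def potential (θ : Fin n → ℝ) (X : Config n m) : ℝ :=
  ∑ i, (((p i).toReal)⁻¹ * (X.1 i : ℝ) ^ 2 - 2 * θ i * X.1 i)

lemma mean_recycle_potential (θ : Fin n → ℝ) :
    mean (recycle p X l) (potential p θ)
      = ∑ i, (((p i).toReal)⁻¹ * mean (recycle p X l) (fun Y => (Y.1 i : ℝ) ^ 2)
        - 2 * θ i * mean (recycle p X l) (fun Y => (Y.1 i : ℝ))) := by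
  have h : potential p θ = fun Y : Config n m =>
      ∑ i, (((p i).toReal)⁻¹ * (Y.1 i : ℝ) ^ 2 - 2 * θ i * Y.1 i) := rfl
  rw [h, mean_finset_sum]
  simp only [mean_sub, mean_const_mul]

/-- The drift of the quadratic potential when bin `l` is recycled. -/
lemma drift_potential (θ : Fin n → ℝ) (hθ : ∀ i, p i = 0 → θ i = 0) :
    (2 * ∑ i, θ i * (p i).toReal - (2 * m + n - 1)) * X.1 l + -(θ l ^ 2 * (p l).toReal)
      ≤ potential p θ X - mean (recycle p X l) (potential p θ) := by
  set q : Fin n → ℝ := fun i => (p i).toReal with hq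
  have hq0 : ∀ i, 0 ≤ q i := fun i => ENNReal.toReal_nonneg
  have hq1 : ∑ i, q i = 1 := sum_toReal_eq_one p
  have hX : ∑ i, (X.1 i : ℝ) = m := by exact_mod_cast X.2
  set k : ℝ := ((X.1 l : ℕ) : ℝ) with hk
  have hk0 : 0 ≤ k := Nat.cast_nonneg _
  -- the change of the potential, term by term
  have hterm : ∀ i, (q i)⁻¹ * mean (recycle p X l) (fun Y => (Y.1 i : ℝ) ^ 2)
        - 2 * θ i * mean (recycle p X l) (fun Y => (Y.1 i : ℝ))
      ≤ ((q i)⁻¹ * (X.1 i : ℝ) ^ 2 - 2 * θ i * X.1 i)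
        + (2 * k * X.1 i + k - k * q i + k ^ 2 * q i - 2 * k * (θ i * q i)
        - if i = l then 2 * k ^ 2 - θ i ^ 2 * q i else 0) := by
    intro i
    rw [mean_recycle_apply, mean_recycle_apply_sq]
    change (q i)⁻¹ * ((X.1 i : ℝ) ^ 2 + 2 * (k * q i) * X.1 i + k * q i * (1 - q i)
      + (k * q i) ^ 2 - if i = l then k ^ 2 + 2 * q i * k ^ 2 else 0)
      - 2 * θ i * (X.1 i + k * q i - if i = l then k else 0) ≤ _
    rcases (hq0 i).eq_or_lt with h | h
    -- Here `(q i)⁻¹ = 0` and `θ i = 0`, so bin `i` does not enter the potential.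
    · have hp : p i = 0 := by
        simpa [hq, ENNReal.toReal_eq_zero_iff, p.apply_ne_top] using h.symm
      rw [← h, hθ i hp]
      have hXi : (0 : ℝ) ≤ X.1 i := Nat.cast_nonneg _
      split_ifs with hil
      · subst hil
        simp only [← hk]
        nlinarith
      · nlinarith [mul_nonneg hk0 hXi]
    · have e : (q i)⁻¹ * q i = 1 := inv_mul_cancel₀ h.ne'
      split_ifs with hil
      -- Completing the square: `-k² / q + 2 θ k` is at most its maximum `θ² q` over real `k`.
      · have hs : 0 ≤ (q i)⁻¹ * (k - θ i * q i) ^ 2 :=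
          mul_nonneg (inv_nonneg.2 h.le) (sq_nonneg _)
        have hs' : (q i)⁻¹ * (k - θ i * q i) ^ 2
            = (q i)⁻¹ * k ^ 2 - 2 * k * θ i + θ i ^ 2 * q i := by
          field_simp
          ring
        have ht : (q i)⁻¹ * ((X.1 i : ℝ) ^ 2 + 2 * (k * q i) * X.1 i + k * q i * (1 - q i)
            + (k * q i) ^ 2 - (k ^ 2 + 2 * q i * k ^ 2))
            = (q i)⁻¹ * (X.1 i : ℝ) ^ 2 + 2 * k * X.1 i + k * (1 - q i) + k ^ 2 * q i
              - (q i)⁻¹ * k ^ 2 - 2 * k ^ 2 := by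
          field_simp
          ring
        rw [ht]
        linarith
      · have ht : (q i)⁻¹ * ((X.1 i : ℝ) ^ 2 + 2 * (k * q i) * X.1 i + k * q i * (1 - q i)
            + (k * q i) ^ 2 - 0)
            = (q i)⁻¹ * (X.1 i : ℝ) ^ 2 + 2 * k * X.1 i + k * (1 - q i) + k ^ 2 * q i := by
          field_simp
          ring
        rw [ht]
        linarith
  have hsum := Finset.sum_le_sum fun i (_ : i ∈ Finset.univ) => hterm i
  rw [← mean_recycle_potential, Finset.sum_add_distrib] at hsum
  change _ ≤ potential p θ X + _ at hsum
  simp only [Finset.sum_sub_distrib, Finset.sum_add_distrib, ← Finset.mul_sum, hq1, hX,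
    Finset.sum_const, Finset.card_univ, Fintype.card_fin, nsmul_eq_mul, Finset.sum_ite_eq',
    Finset.mem_univ, if_true] at hsum
  -- The terms `k² ∑ q i = k²` and `-2k²` leave `-k²`, which is discarded.
  nlinarith [sq_nonneg k]

end Recycle

/-! ### From pointwise drift to stationary laws and time averages. -/

section Averages

variable {n m : ℕ} {S : Type u} (p : PMF (Fin n)) (A : Strategy n m S)
  (μ : PMF (Config n m × S))

lemma choiceLaw_map_fst : (choiceLaw A μ).map Prod.fst = μ.map Prod.fst := by
  rw [choiceLaw, PMF.map_bind, ← PMF.bind_pure_comp]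
  congr 1
  funext z
  rw [PMF.map_comp]
  exact PMF.map_const _ _

/-- The internal state can be forgotten: the next configuration depends only on the current one and
the chosen bin. All expectations thus live on finite types although `S` is arbitrary. -/
lemma bind_step_map_fst :
    (μ.bind (step p A)).map Prod.fst = (choiceLaw A μ).bind fun c => recycle p c.1 c.2 := by
  simp only [choiceLaw, step, PMF.map_bind, PMF.bind_bind, PMF.bind_map, PMF.map_comp]
  congr 1
  funext z
  congr 1
  funext d
  exact PMF.map_id _

lemma pos_of_mem_support_choiceLaw {c : Config n m × Fin n} (hc : c ∈ (choiceLaw A μ).support) :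
    0 < c.1.1 c.2 := by
  simp only [choiceLaw, PMF.mem_support_bind_iff, PMF.mem_support_map_iff] at hc
  obtain ⟨z, -, d, hd, rfl⟩ := hc
  exact A.bin_nonempty _ _ d hd

lemma meanRecycled_eq_mean :
    meanRecycled A μ = mean (choiceLaw A μ) fun c => (c.1.1 c.2 : ℝ) := by
  rw [meanRecycled, tsum_fintype, ENNReal.toReal_sum fun c _ =>
    ENNReal.mul_ne_top (PMF.apply_ne_top _ c) (ENNReal.natCast_ne_top _)]
  simp [mean]

lemma mean_comp_snd_choiceLaw (β : Fin n → ℝ) :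
    mean (choiceLaw A μ) (fun c => β c.2) = ∑ j, β j * pickProb A μ j := by
  rw [← mean_map (choiceLaw A μ) Prod.snd β]
  exact Finset.sum_congr rfl fun j _ => mul_comm _ _

lemma sum_pickProb : ∑ j, pickProb A μ j = 1 := sum_toReal_eq_one _

lemma meanRecycled_nonneg : 0 ≤ meanRecycled A μ := ENNReal.toReal_nonneg

/-- A pointwise drift inequality integrates to an inequality for one round. -/
lemma round_le_of_drift {a : ℝ} {β : Fin n → ℝ} {V : Config n m → ℝ}
    (h : ∀ X l, 0 < X.1 l → a * X.1 l + β l ≤ V X - mean (recycle p X l) V) :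
    a * meanRecycled A μ + ∑ j, β j * pickProb A μ j
      ≤ mean (μ.map Prod.fst) V - mean ((μ.bind (step p A)).map Prod.fst) V := by
  rw [meanRecycled_eq_mean, ← mean_comp_snd_choiceLaw, bind_step_map_fst, mean_bind,
    ← choiceLaw_map_fst A μ, mean_map, ← mean_const_mul, ← mean_add, ← mean_sub]
  exact mean_mono _ fun c hc => h c.1 c.2 (pos_of_mem_support_choiceLaw A μ hc)

lemma stationary_le_of_drift {a : ℝ} {β : Fin n → ℝ} {V : Config n m → ℝ}
    (h : ∀ X l, 0 < X.1 l → a * X.1 l + β l ≤ V X - mean (recycle p X l) V)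
    (hμ : IsStationary p A μ) :
    a * meanRecycled A μ + ∑ j, β j * pickProb A μ j ≤ 0 := by
  have := round_le_of_drift p A μ h
  rwa [hμ, sub_self] at this

/-- There are finitely many configurations, so `V` is bounded and the telescoped sum is bounded
uniformly in `T`. At `T = 0` both sides vanish because `1 / 0 = 0`. -/
lemma average_le_of_drift {a : ℝ} {β : Fin n → ℝ} {V : Config n m → ℝ}
    (h : ∀ X l, 0 < X.1 l → a * X.1 l + β l ≤ V X - mean (recycle p X l) V) :
    ∃ C : ℝ, ∀ T : ℕ,
      a * avgRecycled p A μ T + ∑ j, β j * avgPick p A μ j T ≤ 1 / (T : ℝ) * C := by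
  refine ⟨2 * ∑ X, |V X|, fun T => ?_⟩
  have hb : ∀ κ : PMF (Config n m), |mean κ V| ≤ ∑ X, |V X| := fun κ => by
    refine (Finset.abs_sum_le_sum_abs _ _).trans (Finset.sum_le_sum fun X _ => ?_)
    rw [abs_mul, abs_of_nonneg ENNReal.toReal_nonneg]
    refine mul_le_of_le_one_left (abs_nonneg _) ?_
    simpa using ENNReal.toReal_mono ENNReal.one_ne_top (κ.coe_le_one X)
  have hsum : ∑ t ∈ Finset.range (T + 1), (a * meanRecycled A (law p A μ t)
      + ∑ j, β j * pickProb A (law p A μ t) j) ≤ 2 * ∑ X, |V X| := by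
    refine (Finset.sum_le_sum fun t _ => round_le_of_drift p A (law p A μ t) h).trans ?_
    -- By definition the law after one more round is the bind with `step`, so the sum telescopes.
    change ∑ t ∈ Finset.range (T + 1), (mean ((law p A μ t).map Prod.fst) V
      - mean ((law p A μ (t + 1)).map Prod.fst) V) ≤ _
    rw [Finset.sum_range_sub']
    linarith [(abs_le.1 (hb ((law p A μ (T + 1)).map Prod.fst))).1,
      (abs_le.1 (hb ((law p A μ 0).map Prod.fst))).2]
  have e : a * avgRecycled p A μ T + ∑ j, β j * avgPick p A μ j T
      = 1 / (T : ℝ) * ∑ t ∈ Finset.range (T + 1), (a * meanRecycled A (law p A μ t)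
        + ∑ j, β j * pickProb A (law p A μ t) j) := by
    rw [Finset.sum_add_distrib, Finset.sum_comm, mul_add, Finset.mul_sum Finset.univ]
    simp only [avgRecycled, avgPick]
    congr 1
    · rw [← Finset.mul_sum]
      ring
    · exact Finset.sum_congr rfl fun j _ => by
        rw [← Finset.mul_sum]
        ring
  rw [e]
  exact mul_le_mul_of_nonneg_left hsum (by positivity)

lemma limit_le_of_drift {a : ℝ} {β : Fin n → ℝ} {V : Config n m → ℝ}
    (h : ∀ X l, 0 < X.1 l → a * X.1 l + β l ≤ V X - mean (recycle p X l) V)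
    {R : ℝ} {f : Fin n → ℝ} (hR : HasRecyclingRate p A μ R)
    (hf : ∀ j, HasPickFrequency p A μ j (f j)) :
    a * R + ∑ j, β j * f j ≤ 0 := by
  obtain ⟨C, hC⟩ := average_le_of_drift p A μ h
  refine le_of_tendsto_of_tendsto
    ((hR.const_mul a).add (tendsto_finsetSum _ fun j _ => (hf j).const_mul (β j)))
    (?_ : Tendsto (fun T : ℕ => 1 / (T : ℝ) * C) atTop (𝓝 0)) (Eventually.of_forall hC)
  simpa using (tendsto_one_div_atTop_nhds_zero_nat (𝕜 := ℝ)).mul_const C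

/-- There are `T + 1` rounds but the normalization is `1 / T`, so the total is 1 only in the limit.
-/
lemma sum_avgPick (T : ℕ) : ∑ j, avgPick p A μ j T = 1 / (T : ℝ) * (T + 1) := by
  simp only [avgPick, ← Finset.mul_sum]
  rw [Finset.sum_comm]
  simp [sum_pickProb]

end Averages

/-! ### Choice of the linear coefficients and the resulting bounds. -/

section Bounds

variable {n m : ℕ} (p : PMF (Fin n))

lemma bins_pos {n : ℕ} (p : PMF (Fin n)) : 0 < n := by
  obtain ⟨j, -⟩ := p.support_nonempty
  exact j.pos

lemma balls_pos {X : Config n m} {l : Fin n} (h : 0 < X.1 l) : 0 < m :=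
  h.trans_le ((Finset.single_le_sum (fun _ _ => Nat.zero_le _) (Finset.mem_univ l)).trans X.2.le)

lemma sum_sqrt_pos : 0 < ∑ i, Real.sqrt (p i).toReal := by
  obtain ⟨j, hj⟩ := p.support_nonempty
  exact Finset.sum_pos' (fun i _ => Real.sqrt_nonneg _) ⟨j, Finset.mem_univ j,
    Real.sqrt_pos.2 (ENNReal.toReal_pos ((p.mem_support_iff j).1 hj) (p.apply_ne_top j))⟩

/-- The drift inequality behind the bound by the half quasi-norm. -/
lemma exists_drift_halfNorm : ∃ V : Config n m → ℝ, ∀ X l, 0 < X.1 l →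
    1 * (X.1 l : ℝ) + -((2 * (m : ℝ) + n - 1) / halfNorm p)
      ≤ V X - mean (recycle p X l) V := by
  set s := ∑ i, Real.sqrt (p i).toReal with hs
  have hs0 : 0 < s := sum_sqrt_pos p
  set K : ℝ := 2 * (m : ℝ) + n - 1 with hK
  set θ : Fin n → ℝ := fun i => K / s * (Real.sqrt (p i).toReal)⁻¹ with hθ
  refine ⟨fun X => K⁻¹ * potential p θ X, fun X l hl => ?_⟩
  -- Positivity needs a ball to exist, which the non-empty bin `l` supplies.
  have hK0 : 0 < K := by
    have h1 : (1 : ℝ) ≤ m := by exact_mod_cast balls_pos hl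
    have h2 : (1 : ℝ) ≤ n := by exact_mod_cast bins_pos p
    rw [hK]; linarith
  have hd := drift_potential p X l θ fun i hi => by simp [hθ, hi]
  have h1 : ∑ i, θ i * (p i).toReal = K := by
    have : ∀ i, θ i * (p i).toReal = K / s * Real.sqrt (p i).toReal := fun i => by
      rw [hθ]
      change K / s * (Real.sqrt (p i).toReal)⁻¹ * (p i).toReal = _
      rw [mul_assoc, inv_mul_eq_div, Real.div_sqrt]
    rw [Finset.sum_congr rfl fun i _ => this i, ← Finset.mul_sum, div_mul_cancel₀ _ hs0.ne']
  have h2 : θ l ^ 2 * (p l).toReal ≤ (K / s) ^ 2 := by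
    rw [hθ]
    change (K / s * (Real.sqrt (p l).toReal)⁻¹) ^ 2 * (p l).toReal ≤ _
    rw [mul_pow, inv_pow, Real.sq_sqrt ENNReal.toReal_nonneg, mul_assoc]
    -- Equality holds unless `p l = 0`, where the left side is `0`.
    exact mul_le_of_le_one_right (sq_nonneg _) (inv_mul_le_one)
  have h3 : K * X.1 l - (K / s) ^ 2
      ≤ potential p θ X - mean (recycle p X l) (potential p θ) := by
    rw [h1, ← hK] at hd
    linarith
  rw [mean_const_mul, ← mul_sub]
  refine le_trans (le_of_eq ?_) (mul_le_mul_of_nonneg_left h3 (inv_nonneg.2 hK0.le))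
  rw [halfNorm, ← hs]
  field_simp
  ring

/-- The drift of the number of balls in bin `j`. -/
lemma drift_bin (j : Fin n) (X : Config n m) (l : Fin n) (hl : 0 < X.1 l) :
    0 * (X.1 l : ℝ) + ((p j).toReal - if l = j then (m : ℝ) else 0)
      ≤ -(X.1 j : ℝ) - mean (recycle p X l) (fun Y => -(Y.1 j : ℝ)) := by
  have e : mean (recycle p X l) (fun Y => -(Y.1 j : ℝ))
      = -mean (recycle p X l) (fun Y => (Y.1 j : ℝ)) := by simp [mean]
  rw [e, mean_recycle_apply]
  have h1 : (1 : ℝ) ≤ X.1 l := by exact_mod_cast hl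
  have h2 : (X.1 l : ℝ) ≤ m := by
    exact_mod_cast (Finset.single_le_sum (fun _ _ => Nat.zero_le _) (Finset.mem_univ l)).trans X.2.le
  have h3 : (p j).toReal ≤ X.1 l * (p j).toReal := le_mul_of_one_le_left ENNReal.toReal_nonneg h1
  by_cases hj : l = j
  · simp only [hj, if_true] at *
    linarith
  · simp only [hj, Ne.symm hj, if_false]
    linarith

/-- The bound in terms of the pick frequencies, from the inequalities that all drifts yield. -/
lemma frequency_bound (hp : ∀ j, p j ≠ 0) {R : ℝ} {f : Fin n → ℝ} (hf : ∑ j, f j = 1)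
    (H : ∀ (a : ℝ) (β : Fin n → ℝ) (V : Config n m → ℝ),
      (∀ X l, 0 < X.1 l → a * X.1 l + β l ≤ V X - mean (recycle p X l) V) →
      a * R + ∑ j, β j * f j ≤ 0) :
    (∀ j, 0 < f j) ∧ R ≤ (2 * (m : ℝ) + n - 1) / ∑ j, (p j).toReal / f j := by
  have hp0 : ∀ j, 0 < (p j).toReal := fun j => ENNReal.toReal_pos (hp j) (p.apply_ne_top j)
  have hf0 : ∀ j, 0 < f j := by
    intro j
    -- Bin `j` gains at least `p j` on average per round and loses at most `m`, only when picked;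
    -- balance gives `p j ≤ m * f j`.
    have h := H 0 _ _ (drift_bin p j)
    simp only [sub_mul, Finset.sum_sub_distrib, ← Finset.mul_sum, hf, ite_mul, zero_mul,
      Finset.sum_ite_eq', Finset.mem_univ, if_true] at h
    have h' : 0 < (m : ℝ) * f j := by linarith [hp0 j]
    exact pos_of_mul_pos_right h' (Nat.cast_nonneg m)
  refine ⟨hf0, ?_⟩
  -- Each round recycles at least one ball; the zero potential turns this into a bound on `R`.
  have hR : 1 ≤ R := by
    have h := H (-1) (fun _ => 1) (fun _ => 0) fun X l hl => by
      have h1 : (1 : ℝ) ≤ X.1 l := by exact_mod_cast hl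
      rw [mean_const]
      linarith
    simp only [one_mul, hf] at h
    linarith
  set D := ∑ j, (p j).toReal / f j with hD
  have hD0 : 0 < D :=
    Finset.sum_pos (fun j _ => div_pos (hp0 j) (hf0 j)) ⟨⟨0, bins_pos p⟩, Finset.mem_univ _⟩
  have h := H _ _ _ fun X l _ =>
    drift_potential p X l (fun j => R / f j) fun i hi => absurd hi (hp i)
  have e1 : ∑ i, R / f i * (p i).toReal = R * D := by
    rw [hD, Finset.mul_sum]
    exact Finset.sum_congr rfl fun i _ => by ring
  have e2 : ∑ j, -((R / f j) ^ 2 * (p j).toReal) * f j = -(R ^ 2 * D) := by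
    rw [hD, Finset.mul_sum, ← Finset.sum_neg_distrib]
    refine Finset.sum_congr rfl fun i _ => ?_
    have := (hf0 i).ne'
    field_simp
  rw [e1, e2] at h
  rw [le_div_iff₀ hD0]
  -- The drift inequality now reads `(2RD - (2m + n - 1)) R ≤ R² D`; cancelling one factor `R > 0`
  -- gives the claim.
  refine le_of_mul_le_mul_left ?_ (zero_lt_one.trans_le hR)
  linarith

lemma avgRecycled_le {S : Type u} (A : Strategy n m S) (ν : PMF (Config n m × S)) :
    ∃ C : ℝ, ∀ T : ℕ, avgRecycled p A ν T
      ≤ 1 / (T : ℝ) * (T + 1) * ((2 * (m : ℝ) + n - 1) / halfNorm p) + 1 / (T : ℝ) * C := by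
  obtain ⟨V, hV⟩ := exists_drift_halfNorm (m := m) p
  obtain ⟨C, hC⟩ := average_le_of_drift p A ν hV
  refine ⟨C, fun T => ?_⟩
  have h := hC T
  rw [← Finset.mul_sum, sum_avgPick] at h
  linarith

lemma tendsto_bound (B C : ℝ) :
    Tendsto (fun T : ℕ => 1 / (T : ℝ) * (T + 1) * B + 1 / (T : ℝ) * C) atTop (𝓝 B) := by
  have h0 := tendsto_one_div_atTop_nhds_zero_nat (𝕜 := ℝ)
  have h1 : Tendsto (fun T : ℕ => B + 1 / (T : ℝ) * (B + C)) atTop (𝓝 B) := by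
    simpa using (h0.mul_const (B + C)).const_add B
  refine h1.congr' ?_
  filter_upwards [eventually_gt_atTop 0] with T hT
  have : (T : ℝ) ≠ 0 := by exact_mod_cast hT.ne'
  field_simp
  ring

lemma avgRecycled_nonneg {S : Type u} (A : Strategy n m S) (ν : PMF (Config n m × S)) (T : ℕ) :
    0 ≤ avgRecycled p A ν T :=
  mul_nonneg (by positivity) (Finset.sum_nonneg fun _ _ => meanRecycled_nonneg A _)

lemma limsup_avgRecycled_le {S : Type u} (A : Strategy n m S) (ν : PMF (Config n m × S)) :
    limsup (avgRecycled p A ν) atTop ≤ (2 * (m : ℝ) + n - 1) / halfNorm p := by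
  obtain ⟨C, hC⟩ := avgRecycled_le p A ν
  have ht := tendsto_bound ((2 * (m : ℝ) + n - 1) / halfNorm p) C
  rw [← ht.limsup_eq]
  exact limsup_le_limsup (Eventually.of_forall hC)
    -- Comparing real `limsup`s requires the smaller sequence to be bounded below, here by `0`.
    (IsBoundedUnder.isCoboundedUnder_le
      (isBoundedUnder_of ⟨0, fun T => avgRecycled_nonneg p A ν T⟩))
    ht.isBoundedUnder_le

lemma stationary_meanRecycled_le {S : Type u} (A : Strategy n m S)
    (χ : PMF (Config n m × S)) (hχ : IsStationary p A χ) :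
    meanRecycled A χ ≤ (2 * (m : ℝ) + n - 1) / halfNorm p := by
  obtain ⟨V, hV⟩ := exists_drift_halfNorm (m := m) p
  have h := stationary_le_of_drift p A χ hV hχ
  rw [← Finset.mul_sum, sum_pickProb] at h
  linarith

lemma sum_frequency_eq_one {S : Type u} (A : Strategy n m S) (ν : PMF (Config n m × S))
    {f : Fin n → ℝ} (hf : ∀ j, HasPickFrequency p A ν j (f j)) : ∑ j, f j = 1 := by
  refine tendsto_nhds_unique (tendsto_finsetSum Finset.univ fun j _ => hf j) ?_
  simpa [sum_avgPick] using tendsto_bound 1 0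

end Bounds

end BallRecycling

theorem mainTheorem2 (n m : ℕ) (p : PMF (Fin n)) :
    -- every strategy
    (∀ (S : Type u) (A : BallRecycling.Strategy n m S),
      (∀ ν : PMF (BallRecycling.Config n m × S),
        limsup (BallRecycling.avgRecycled p A ν) atTop
            ≤ (2 * (m : ℝ) + n - 1) / BallRecycling.halfNorm p ∧
        ∀ R : ℝ, BallRecycling.HasRecyclingRate p A ν R →
          R ≤ (2 * (m : ℝ) + n - 1) / BallRecycling.halfNorm p) ∧
      (∀ χ : PMF (BallRecycling.Config n m × S), BallRecycling.IsStationary p A χ →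
        BallRecycling.meanRecycled A χ
          ≤ (2 * (m : ℝ) + n - 1) / BallRecycling.halfNorm p)) ∧
    -- stateless strategies, in terms of the frequencies with which the bins are picked
    ((∀ j, p j ≠ 0) → ∀ A : BallRecycling.Strategy n m Unit,
      (∀ χ : PMF (BallRecycling.Config n m × Unit), BallRecycling.IsStationary p A χ →
        (∀ j, 0 < BallRecycling.pickProb A χ j) ∧
        BallRecycling.meanRecycled A χ
          ≤ (2 * (m : ℝ) + n - 1) / ∑ j, (p j).toReal / BallRecycling.pickProb A χ j) ∧
      (∀ (ν : PMF (BallRecycling.Config n m × Unit)) (R : ℝ) (f : Fin n → ℝ),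
        BallRecycling.HasRecyclingRate p A ν R →
        (∀ j, BallRecycling.HasPickFrequency p A ν j (f j)) →
        (∀ j, 0 < f j) ∧
        R ≤ (2 * (m : ℝ) + n - 1) / ∑ j, (p j).toReal / f j)) := by
  refine ⟨fun S A => ⟨fun ν => ⟨BallRecycling.limsup_avgRecycled_le p A ν, fun R hR => ?_⟩,
    BallRecycling.stationary_meanRecycled_le p A⟩, fun hp A => ⟨fun χ hχ => ?_, fun ν R f hR hf => ?_⟩⟩
  · rw [← hR.limsup_eq]
    exact BallRecycling.limsup_avgRecycled_le p A ν
  · exact BallRecycling.frequency_bound p hp (BallRecycling.sum_pickProb A χ)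
      fun _ _ _ h => BallRecycling.stationary_le_of_drift p A χ h hχ
  · exact BallRecycling.frequency_bound p hp (BallRecycling.sum_frequency_eq_one p A ν hf)
      fun _ _ _ h => BallRecycling.limit_le_of_drift p A ν h hR hf
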